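/- All rings are associative with $1$, and modules are right modules. A pp formula over a ring $R$ is a formula $\phi(\overline{x}) = \exists\overline{y}\,(\overline{x}A+\overline{y}B=0)$ with $A,B$ matrices over $R$; its solution set in $M\in \mathrm{Mod}\text{-}R$ is $\phi(M)=\{\overline{a}\in M^n : \exists\,\overline{b}\in M^t,\ \overline{a}A+\overline{b}B=0\}$. A pp-pair $\phi/\psi$ consists of pp formulas in the same free variables with $\psi(M)\subseteq\phi(M)$ for every $R$-module $M$; it is closed on $M$ if $\phi(M)=\psi(M)$. A definable subcategory of $\mathrm{Mod}\text{-}R$ is a class of the form $\{M : \text{every pair in } \Phi \text{ is closed on } M\}$ for some set $\Phi$ of pp-pairs. Let $f:R\to S$ be a ring homomorphism. For a pp formula $\phi$ over $R$ let $f_*\phi$ be the pp formula over $S$ obtained by applying $f$ to the entries of its matrices. For a definable subcategory $\mathcal D$ of $\mathrm{Mod}\text{-}R$, let $\mathcal D^S=\{M\in\mathrm{Mod}\text{-}S : M_R\in\mathcal D\}$, where $M_R$ is $M$ regarded as an $R$-module via $f$, and let $\mathcal D\otimes_R S$ be the smallest definable subcategory of $\mathrm{Mod}\text{-}S$ containing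 $M\otimes_R S$ for all $M\in\mathcal D$. For a definable subcategory $\mathcal C$ of $\mathrm{Mod}\text{-}S$, let $\mathcal C|_R$ be the definable subcategory of $\mathrm{Mod}\text{-}R$ defined by all pp-pairs $\phi/\psi$ over $R$ such that $f_*\phi/f_*\psi$ is closed on every module in $\mathcal C$. **Corollary.** Suppose that $R$ is a finite-dimensional algebra over a field and that $f:R\to S$ is an elementary embedding of rings, $R\prec S$ (that is, a first-order sentence in the language of rings with parameters from $R$ is true in $R$ if and only if, with the parameters replaced by their images under $f$, it is true in $S$). Let $\mathcal D$ be a definable subcategory of $\mathrm{Mod}\text{-}R$. Then $(\mathcal D\otimes_R S)|_R=\mathcal D$, and hence $\mathcal D\otimes_R S\subseteq \mathcal D^S$. -/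

import Mathlib

open CategoryTheory
open scoped TensorProduct

universe u

/- Right modules over a (not necessarily commutative) ring `R` are modules over `Rᵐᵒᵖ`: the element
`x r` is `MulOpposite.op r • x`, and `Mod-R` is `ModuleCat.{u} Rᵐᵒᵖ`. A (full, replete) subcategory
of `Mod-R` is an `ObjectProperty`; inclusion of subcategories is `≤`. -/

/-- A pp formula `∃ y, x A + y B = 0` for right `R`-modules with `n` free variables `x`;
`t` is the number of quantified variables and `m` the number of equations. -/
structure PPFormula (R : Type u) (n : ℕ) where
  t : ℕ
  m : ℕ
  A : Matrix (Fin n) (Fin m) R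
  B : Matrix (Fin t) (Fin m) R

namespace PPFormula

/-- The solution set `φ(M)` of a pp formula in a right `R`-module `M`. -/
def sol {R : Type u} [Ring R] {n : ℕ} (φ : PPFormula R n) (M : Type*) [AddCommGroup M]
    [Module Rᵐᵒᵖ M] : Set (Fin n → M) :=
  {a | ∃ b : Fin φ.t → M, ∀ j : Fin φ.m,
    ∑ i, MulOpposite.op (φ.A i j) • a i + ∑ k, MulOpposite.op (φ.B k j) • b k = 0}

/-- The formula `f_* φ`: each ring element `r` occurring in `φ` is replaced by `f r`. -/
def map {R S : Type u} [Ring R] [Ring S] (f : R →+* S) {n : ℕ} (φ : PPFormula R n) :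
    PPFormula S n where
  t := φ.t
  m := φ.m
  A := φ.A.map f
  B := φ.B.map f

theorem sol_map {R S : Type u} [Ring R] [Ring S] (f : R →+* S) {n : ℕ} (φ : PPFormula R n)
    (N : ModuleCat.{u} Sᵐᵒᵖ) :
    (φ.map f).sol N = φ.sol ((ModuleCat.restrictScalars (RingHom.op f)).obj N) :=
  rfl

end PPFormula

/-- A pp-pair `φ/ψ` for right `R`-modules: pp formulas in the same free variables with `ψ ≤ φ`. -/
structure PPPair (R : Type u) [Ring R] where
  n : ℕ
  φ : PPFormula R n
  ψ : PPFormula R n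
  le : ∀ M : ModuleCat.{u} Rᵐᵒᵖ, ψ.sol M ⊆ φ.sol M

namespace PPPair

/-- The pp-pair `φ/ψ` is closed on `M`: `φ(M) = ψ(M)`. -/
def ClosedOn {R : Type u} [Ring R] (p : PPPair R) (M : ModuleCat.{u} Rᵐᵒᵖ) : Prop :=
  p.φ.sol M = p.ψ.sol M

/-- The pp-pair `f_* φ / f_* ψ`. -/
def map {R S : Type u} [Ring R] [Ring S] (f : R →+* S) (p : PPPair R) : PPPair S where
  n := p.n
  φ := p.φ.map f
  ψ := p.ψ.map f
  le N := p.le ((ModuleCat.restrictScalars (RingHom.op f)).obj N)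

end PPPair

/-- The subcategory of `Mod-R` defined by a set `Φ` of pp-pairs. -/
def definedBy {R : Type u} [Ring R] (Φ : Set (PPPair R)) :
    ObjectProperty (ModuleCat.{u} Rᵐᵒᵖ) :=
  fun M => ∀ p ∈ Φ, p.ClosedOn M

/-- Definable subcategories of `Mod-R`: those defined by some set of pp-pairs. -/
def IsDefinable {R : Type u} [Ring R] (D : ObjectProperty (ModuleCat.{u} Rᵐᵒᵖ)) : Prop :=
  ∃ Φ : Set (PPPair R), D = definedBy Φ

/-- The set of all pp-pairs closed on (every module in) a class `C`. -/
def closedPairs {R : Type u} [Ring R] (C : ObjectProperty (ModuleCat.{u} Rᵐᵒᵖ)) :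
    Set (PPPair R) :=
  {p | ∀ M, C M → p.ClosedOn M}

/-- The smallest definable subcategory `⟨X⟩` containing a class `X` of modules. -/
def definableClosure {R : Type u} [Ring R] (X : ObjectProperty (ModuleCat.{u} Rᵐᵒᵖ)) :
    ObjectProperty (ModuleCat.{u} Rᵐᵒᵖ) :=
  fun M => ∀ E : ObjectProperty (ModuleCat.{u} Rᵐᵒᵖ), IsDefinable E → X ≤ E → E M

theorem definableClosure_eq {R : Type u} [Ring R] (X : ObjectProperty (ModuleCat.{u} Rᵐᵒᵖ)) :
    definableClosure X = definedBy (closedPairs X) := by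
  funext M
  refine propext ⟨fun h => h _ ⟨_, rfl⟩ fun N hN p hp => hp N hN, ?_⟩
  rintro h E ⟨Φ, rfl⟩ hX p hp
  exact h p fun N hN => hX N hN p hp

theorem isDefinable_definableClosure {R : Type u} [Ring R]
    (X : ObjectProperty (ModuleCat.{u} Rᵐᵒᵖ)) : IsDefinable (definableClosure X) :=
  ⟨_, definableClosure_eq X⟩

/-- The relations `(m r) ⊗ s = m ⊗ (f r) s` defining `M ⊗_R S` as a quotient of the tensor product
over `ℤ`. The factor `S` is written on the left, so that the right `S`-action on
`S ⊗[ℤ] M` by right multiplication on `S` is the one provided by Mathlib. -/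
def tensorRel {R S : Type u} [Ring R] [Ring S] (f : R →+* S) (M : Type u) [AddCommGroup M]
    [Module Rᵐᵒᵖ M] : Submodule Sᵐᵒᵖ (S ⊗[ℤ] M) :=
  Submodule.span Sᵐᵒᵖ
    {z | ∃ (s : S) (r : R) (m : M), z = s ⊗ₜ[ℤ] (MulOpposite.op r • m) - (f r * s) ⊗ₜ[ℤ] m}

/-- The right `S`-module `M ⊗_R S`, for a right `R`-module `M` and a ring homomorphism
`f : R →+* S`, with `S` a left `R`-module via `f`. -/
noncomputable def tensorObj {R S : Type u} [Ring R] [Ring S] (f : R →+* S)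
    (M : ModuleCat.{u} Rᵐᵒᵖ) : ModuleCat.{u} Sᵐᵒᵖ :=
  ModuleCat.of Sᵐᵒᵖ ((S ⊗[ℤ] (M : Type u)) ⧸ tensorRel f M)

/-- The tensor extension `D ⊗_R S = ⟨{M ⊗_R S : M ∈ D}⟩`. -/
def tensorExtension {R S : Type u} [Ring R] [Ring S] (f : R →+* S)
    (D : ObjectProperty (ModuleCat.{u} Rᵐᵒᵖ)) : ObjectProperty (ModuleCat.{u} Sᵐᵒᵖ) :=
  definableClosure fun N => ∃ M, D M ∧ N = tensorObj f M

/-- The direct extension `D^S = {N_S : N_R ∈ D}`. -/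
def directExtension {R S : Type u} [Ring R] [Ring S] (f : R →+* S)
    (D : ObjectProperty (ModuleCat.{u} Rᵐᵒᵖ)) : ObjectProperty (ModuleCat.{u} Sᵐᵒᵖ) :=
  fun N => D ((ModuleCat.restrictScalars (RingHom.op f)).obj N)

/-- The definable restriction `C|_R`: the subcategory of `Mod-R` defined by all pp-pairs `φ/ψ` for
`R`-modules such that `f_* φ / f_* ψ` is closed on `C`. -/
def definableRestriction {R S : Type u} [Ring R] [Ring S] (f : R →+* S)
    (C : ObjectProperty (ModuleCat.{u} Sᵐᵒᵖ)) : ObjectProperty (ModuleCat.{u} Rᵐᵒᵖ) :=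
  definedBy {p | p.map f ∈ closedPairs C}

/-- `R ≺ S` along `f`: the ring homomorphism `f` is an elementary embedding of structures for the
first-order language of rings. -/
def IsElementaryExtension {R S : Type u} [Ring R] [Ring S] (f : R →+* S) : Prop :=
  letI := FirstOrder.Ring.compatibleRingOfRing R
  letI := FirstOrder.Ring.compatibleRingOfRing S
  ∃ g : FirstOrder.Language.ElementaryEmbedding FirstOrder.Language.ring R S, ∀ r, g r = f r

/-! Let `C` and `E` be the centers of `R` and `S`. Since `R` is finite-dimensional, `C` is
Noetherian and `R` is a finite `C`-module. Centrality is first-order, so `f` maps `C` into `E`, and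
three facts transfer from `R` to `S`: fixed `C`-generators of `R` also generate `S` over `E`;
finitely many central syzygies of a tuple from `R` still generate all of them; an equation `∑ a_q
y_q = 1` with `a_q` in `C` that is solvable in `E` is solvable in `C`. Hence `R ⊗[C] E → S` is
bijective and `E` is faithfully flat over `C`.

Thus `M ⊗_R S` is `M ⊗[C] E`. By flatness the solutions of a pp formula there are sums of `m ⊗ z`
with `m` a solution in `M`; by faithfulness no new inclusion between solution sets appears. So a
pp-pair is closed on `M` iff its image is closed on `M ⊗_R S` (`closedOn_map_tensorObj_iff`), and
both claims follow formally. -/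

/-! ### First-order transfer of statements about central elements. -/

section Transfer

open FirstOrder FirstOrder.Language FirstOrder.Ring

/-- The term `∑ i, t i` in the language of rings. -/
noncomputable def ringSumTerm {α ι : Type*} [Fintype ι] (t : ι → ring.Term α) : ring.Term α :=
  (Finset.univ.toList.map t).foldr (· + ·) 0

theorem realize_ringSumTerm {α ι A : Type*} [Fintype ι] [Ring A] [CompatibleRing A]
    (t : ι → ring.Term α) (v : α → A) :
    (ringSumTerm t).realize v = ∑ i, (t i).realize v := by
  have h (l : List ι) : ((l.map t).foldr (· + ·) 0).realize v
      = (l.map fun i => (t i).realize v).sum := by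
    induction l with
    | nil => simp
    | cons a l ih => simp [ih]
  rw [ringSumTerm, h, Finset.sum_map_toList]

/-- The formula expressing that the value of a term is central. -/
noncomputable def centralFormula {α : Type*} (t : ring.Term α) : ring.Formula α :=
  Formula.iAlls Unit (Term.equal (Term.var (Sum.inr ()) * t.relabel Sum.inl)
    (t.relabel Sum.inl * Term.var (Sum.inr ())))

theorem realize_centralFormula {α A : Type*} [Ring A] [CompatibleRing A]
    (t : ring.Term α) (v : α → A) :
    (centralFormula t).Realize v ↔ t.realize v ∈ Subring.center A := by
  rw [centralFormula, Formula.realize_iAlls, Subring.mem_center_iff]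
  simp only [Formula.realize_equal, realize_mul, Term.realize_var, Term.realize_relabel,
    Sum.elim_inr]
  exact ⟨fun h g => h fun _ => g, fun h i => h (i ())⟩

variable {R S : Type u} [Ring R] [Ring S] {f : R →+* S}

theorem IsElementaryExtension.map_mem_center (hf : IsElementaryExtension f) {c : R}
    (hc : c ∈ Subring.center R) : f c ∈ Subring.center S := by
  let _ := compatibleRingOfRing R
  let _ := compatibleRingOfRing S
  obtain ⟨g, hg⟩ := hf
  have h := g.map_formula (centralFormula (Term.var ())) fun _ => c
  simp only [realize_centralFormula, Term.realize_var, Function.comp_apply, hg] at h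
  exact h.2 hc

/-- Gives surjectivity of `R ⊗[C] E → S`. -/
theorem IsElementaryExtension.exists_central_sum_eq (hf : IsElementaryExtension f)
    {ι : Type*} [Fintype ι] (e : ι → R)
    (he : ∀ r, ∃ z : ι → R, (∀ i, z i ∈ Subring.center R) ∧ ∑ i, e i * z i = r) (s : S) :
    ∃ z : ι → S, (∀ i, z i ∈ Subring.center S) ∧ ∑ i, f (e i) * z i = s := by
  let _ := compatibleRingOfRing R
  let _ := compatibleRingOfRing S
  obtain ⟨g, hg⟩ := hf
  have h := g.map_formula (Formula.iAlls Unit <| Formula.iExs ι <|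
    (Formula.iInf fun i : ι => centralFormula (Term.var (Sum.inr i))) ⊓
      Term.equal (ringSumTerm fun i : ι => Term.var (Sum.inl (Sum.inl i)) * Term.var (Sum.inr i))
        (Term.var (Sum.inl (Sum.inr ())))) e
  simp only [Formula.realize_iAlls, Formula.realize_iExs, Formula.realize_inf,
    Formula.realize_iInf, realize_centralFormula, Formula.realize_equal, realize_ringSumTerm,
    realize_mul, Term.realize_var, Sum.elim_inl, Sum.elim_inr, Function.comp_apply, hg] at h
  exact h.2 (fun r => he (r ())) fun _ => s

/-- The faithful part of faithful flatness: a proper ideal of `C` stays proper in `E`. -/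
theorem IsElementaryExtension.exists_central_sum_eq_one (hf : IsElementaryExtension f)
    {ι : Type*} [Fintype ι] (a : ι → R)
    (h : ∃ z : ι → S, (∀ i, z i ∈ Subring.center S) ∧ ∑ i, f (a i) * z i = 1) :
    ∃ z : ι → R, (∀ i, z i ∈ Subring.center R) ∧ ∑ i, a i * z i = 1 := by
  let _ := compatibleRingOfRing R
  let _ := compatibleRingOfRing S
  obtain ⟨g, hg⟩ := hf
  have key := g.map_formula (Formula.iExs ι <|
    (Formula.iInf fun i : ι => centralFormula (Term.var (Sum.inr i))) ⊓
      Term.equal (ringSumTerm fun i : ι => Term.var (Sum.inl i) * Term.var (Sum.inr i)) 1) a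
  simp only [Formula.realize_iExs, Formula.realize_inf,
    Formula.realize_iInf, realize_centralFormula, Formula.realize_equal, realize_ringSumTerm,
    realize_mul, realize_one, Term.realize_var, Sum.elim_inl, Sum.elim_inr, Function.comp_apply,
    hg] at key
  exact key.1 h

/-- If the central solutions of a linear equation over `R` are generated by the rows of `b`, the
same holds over an elementary extension. -/
theorem IsElementaryExtension.exists_central_syzygy (hf : IsElementaryExtension f)
    {ι κ : Type*} [Fintype ι] [Fintype κ] (a : ι → R) (b : κ → ι → R)
    (h : ∀ x : ι → R, (∀ i, x i ∈ Subring.center R) → ∑ i, a i * x i = 0 →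
      ∃ y : κ → R, (∀ k, y k ∈ Subring.center R) ∧ ∀ i, x i = ∑ k, b k i * y k)
    (x : ι → S) (hx : ∀ i, x i ∈ Subring.center S) (hax : ∑ i, f (a i) * x i = 0) :
    ∃ y : κ → S, (∀ k, y k ∈ Subring.center S) ∧ ∀ i, x i = ∑ k, f (b k i) * y k := by
  let _ := compatibleRingOfRing R
  let _ := compatibleRingOfRing S
  obtain ⟨g, hg⟩ := hf
  let α := ι ⊕ κ × ι
  have key := g.map_formula (Formula.iAlls ι <|
    (Formula.iInf fun i : ι => centralFormula (Term.var (Sum.inr i : α ⊕ ι))).imp <|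
    (Term.equal (ringSumTerm fun i : ι =>
      Term.var (Sum.inl (Sum.inl i)) * Term.var (Sum.inr i)) 0).imp <|
    Formula.iExs κ <| (Formula.iInf fun k : κ => centralFormula (Term.var (Sum.inr k))) ⊓
      Formula.iInf fun i : ι => Term.equal (Term.var (Sum.inl (Sum.inr i)))
        (ringSumTerm fun k : κ =>
          Term.var (Sum.inl (Sum.inl (Sum.inr (k, i)))) * Term.var (Sum.inr k)))
    (Sum.elim a fun p => b p.1 p.2)
  simp only [Formula.realize_iAlls, Formula.realize_iExs, Formula.realize_inf,
    Formula.realize_imp, Formula.realize_iInf, realize_centralFormula, Formula.realize_equal,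
    realize_ringSumTerm, realize_mul, realize_zero, Term.realize_var, Sum.elim_inl,
    Sum.elim_inr, Function.comp_apply, hg] at key
  exact key.2 h x hx hax

end Transfer

/-! ### Linear systems over right modules. -/

section LinearSystem

variable {R : Type u} [Ring R] {n t m : ℕ}
  (A : Matrix (Fin n) (Fin m) R) (B : Matrix (Fin t) (Fin m) R)

/-- The left-hand sides `x A + y B` of a system of linear equations over a right module. -/
def systemLhs (M : Type*) [AddCommGroup M] [Module Rᵐᵒᵖ M] :
    (Fin n → M) × (Fin t → M) →+ (Fin m → M) where
  toFun x j := ∑ i, MulOpposite.op (A i j) • x.1 i + ∑ k, MulOpposite.op (B k j) • x.2 k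
  map_zero' := by ext; simp
  map_add' x y := by
    ext
    simp only [Prod.fst_add, Prod.snd_add, Pi.add_apply, smul_add, Finset.sum_add_distrib]
    abel

theorem systemLhs_apply {M : Type*} [AddCommGroup M] [Module Rᵐᵒᵖ M]
    (x : (Fin n → M) × (Fin t → M)) (j : Fin m) :
    systemLhs A B M x j = ∑ i, MulOpposite.op (A i j) • x.1 i +
      ∑ k, MulOpposite.op (B k j) • x.2 k :=
  rfl

theorem systemLhs_sum {M ι : Type*} [AddCommGroup M] [Module Rᵐᵒᵖ M] [Fintype ι]
    (a : ι → Fin n → M) (b : ι → Fin t → M) :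
    systemLhs A B M (∑ l, a l, ∑ l, b l) = ∑ l, systemLhs A B M (a l, b l) := by
  rw [← map_sum]
  congr 1
  ext <;> simp [Prod.fst_sum, Prod.snd_sum]

theorem systemLhs_smul {C M : Type*} [CommRing C] [Algebra C R] [AddCommGroup M] [Module Rᵐᵒᵖ M]
    [Module C M] [IsScalarTower C Rᵐᵒᵖ M] (c : C) (a : Fin n → M) (b : Fin t → M) :
    systemLhs A B M (c • a, c • b) = c • systemLhs A B M (a, b) := by
  ext j
  simp only [systemLhs_apply, Pi.smul_apply, smul_add, Finset.smul_sum]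
  congr 1 <;> refine Finset.sum_congr rfl fun i _ => ?_ <;> rw [smul_algebra_smul_comm]

theorem systemLhs_map {S : Type u} [Ring S] (f : R →+* S) {M N : Type*} [AddCommGroup M]
    [Module Rᵐᵒᵖ M] [AddCommGroup N] [Module Sᵐᵒᵖ N] (h : M →+ N)
    (hh : ∀ r m, h (MulOpposite.op r • m) = MulOpposite.op (f r) • h m)
    (a : Fin n → M) (b : Fin t → M) :
    systemLhs (A.map f) (B.map f) N (h ∘ a, h ∘ b) = h ∘ systemLhs A B M (a, b) := by
  ext j
  simp only [Function.comp_apply, systemLhs_apply, map_add, map_sum, hh, Matrix.map_apply]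

end LinearSystem

namespace PPFormula

variable {R : Type u} [Ring R] {n : ℕ} (φ : PPFormula R n)

theorem mem_sol_iff {M : Type*} [AddCommGroup M] [Module Rᵐᵒᵖ M] (a : Fin n → M) :
    a ∈ φ.sol M ↔ ∃ b, systemLhs φ.A φ.B M (a, b) = 0 := by
  simp only [funext_iff]
  rfl

theorem sum_mem_sol {M ι : Type*} [AddCommGroup M] [Module Rᵐᵒᵖ M] [Fintype ι]
    {a : ι → Fin n → M} (h : ∀ l, a l ∈ φ.sol M) : ∑ l, a l ∈ φ.sol M := by
  simp only [mem_sol_iff] at h ⊢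
  choose b hb using h
  exact ⟨∑ l, b l, by simp [systemLhs_sum, hb]⟩

variable {S : Type u} [Ring S] (f : R →+* S)

theorem mem_sol_map_iff {N : Type*} [AddCommGroup N] [Module Sᵐᵒᵖ N] (a : Fin n → N) :
    a ∈ (φ.map f).sol N ↔
      ∃ b : Fin φ.t → N, systemLhs (φ.A.map f) (φ.B.map f) N (a, b) = 0 :=
  mem_sol_iff _ _

theorem comp_mem_sol_map {M N : Type*} [AddCommGroup M] [Module Rᵐᵒᵖ M] [AddCommGroup N]
    [Module Sᵐᵒᵖ N] (h : M →+ N)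
    (hh : ∀ r m, h (MulOpposite.op r • m) = MulOpposite.op (f r) • h m)
    {a : Fin n → M} (ha : a ∈ φ.sol M) : h ∘ a ∈ (φ.map f).sol N := by
  rw [mem_sol_iff] at ha
  obtain ⟨b, hb⟩ := ha
  refine (mem_sol_map_iff _ _ _).2 ⟨h ∘ b, ?_⟩
  rw [systemLhs_map _ _ f h hh, hb]
  ext
  simp

end PPFormula

/-! ### Generators and universal property of `M ⊗_R S`. -/

section TensorObj

variable {R S : Type u} [Ring R] [Ring S] (f : R →+* S) (M : ModuleCat.{u} Rᵐᵒᵖ)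

/-- The map `(s, m) ↦ m ⊗ s` to `M ⊗_R S`. -/
noncomputable def tensorObjMk : S →+ M →+ tensorObj f M where
  toFun s :=
    { toFun := fun m => (tensorRel f M).mkQ (s ⊗ₜ[ℤ] m)
      map_zero' := by rw [TensorProduct.tmul_zero, map_zero]; rfl
      map_add' := fun x y => by rw [TensorProduct.tmul_add, map_add]; rfl }
  map_zero' := by
    ext m
    change (tensorRel f M).mkQ (0 ⊗ₜ[ℤ] m) = _
    rw [TensorProduct.zero_tmul, map_zero]
    rfl
  map_add' s t := by
    ext m
    change (tensorRel f M).mkQ ((s + t) ⊗ₜ[ℤ] m) = _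
    rw [TensorProduct.add_tmul, map_add]
    rfl

theorem tensorObjMk_op_smul (s : S) (r : R) (m : M) :
    tensorObjMk f M s (MulOpposite.op r • m) = tensorObjMk f M (f r * s) m :=
  (Submodule.Quotient.eq _).2 (Submodule.subset_span ⟨s, r, m, rfl⟩)

theorem op_smul_tensorObjMk (s t : S) (m : M) :
    MulOpposite.op t • tensorObjMk f M s m = tensorObjMk f M (s * t) m :=
  rfl

theorem tensorObj_induction {P : tensorObj f M → Prop} (h0 : P 0)
    (hmk : ∀ s m, P (tensorObjMk f M s m)) (hadd : ∀ x y, P x → P y → P (x + y))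
    (x : tensorObj f M) : P x := by
  obtain ⟨x, rfl⟩ := (tensorRel f M).mkQ_surjective x
  induction x with
  | zero => rw [map_zero]; exact h0
  | tmul s m => exact hmk s m
  | add x y hx hy => rw [map_add]; exact hadd _ _ hx hy

theorem exists_tensorObj_lift {P : Type*} [AddCommGroup P] (h : S →+ M →+ P)
    (hh : ∀ s r m, h s (MulOpposite.op r • m) = h (f r * s) m) :
    ∃ Φ : tensorObj f M →+ P, ∀ s m, Φ (tensorObjMk f M s m) = h s m := by
  let H : S ⊗[ℤ] M →+ P := TensorProduct.liftAddHom h fun r s m => by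
    rw [map_zsmul, map_zsmul]; rfl
  -- `H` is only additive while the relations form an `S`-span, so vanishing is proved for all
  -- multiples of `z` at once.
  have hker : ∀ z ∈ tensorRel f M, ∀ t : S, H (MulOpposite.op t • z) = 0 := by
    intro z hz
    induction hz using Submodule.span_induction with
    | mem z hz =>
      obtain ⟨s, r, m, rfl⟩ := hz
      intro t
      rw [smul_sub]
      change H ((s * t) ⊗ₜ[ℤ] (MulOpposite.op r • m) - (f r * s * t) ⊗ₜ[ℤ] m) = 0
      rw [map_sub]
      change h _ _ - h _ _ = 0
      rw [hh, mul_assoc, sub_self]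
    | zero => simp
    | add x y _ _ hx hy => intro t; rw [smul_add, map_add, hx, hy, add_zero]
    | smul a x _ hx =>
      intro t
      rw [smul_smul]
      exact hx (a.unop * t)
  refine ⟨QuotientAddGroup.lift (tensorRel f M).toAddSubgroup H fun z hz => ?_, fun s m => rfl⟩
  simpa using hker z hz 1

end TensorObj

/-! ### pp formulas under a flat central extension `S = R ⊗[C] E`. -/

section CentralExtension

variable {C E R S : Type u} [CommRing C] [CommRing E] [Ring R] [Ring S] [Algebra C E]
  [Algebra C R] [Algebra C S] [Algebra E S] [IsScalarTower C E S] (f : R →ₐ[C] S)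

/-- The multiplication map `R ⊗ E → S` for a central subalgebra `E` of `S`. -/
noncomputable def centralMul (E : Type u) [CommRing E] [Algebra C E] [Algebra E S]
    [IsScalarTower C E S] : R ⊗[C] E →ₐ[C] S :=
  Algebra.TensorProduct.lift f (IsScalarTower.toAlgHom C E S)
    fun r z => (Algebra.commutes z (f r)).symm

theorem centralMul_tmul (r : R) (z : E) :
    centralMul f E (r ⊗ₜ z) = f r * algebraMap E S z :=
  Algebra.TensorProduct.lift_tmul ..

variable (M : ModuleCat.{u} Rᵐᵒᵖ)

/-- The map `m ↦ m ⊗ z` for a central element `z`. -/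
noncomputable def tensorObjCentral (z : E) : M →+ tensorObj (f : R →+* S) M :=
  tensorObjMk (f : R →+* S) M (algebraMap E S z)

omit [Algebra C E] [IsScalarTower C E S] in
theorem tensorObjCentral_op_smul (z : E) (r : R) (m : M) :
    tensorObjCentral f M z (MulOpposite.op r • m) =
      MulOpposite.op (f r) • tensorObjCentral f M z m := by
  rw [tensorObjCentral, tensorObjMk_op_smul, op_smul_tensorObjMk, Algebra.commutes]
  rfl

omit [Algebra C E] [IsScalarTower C E S] in
theorem tensorObjCentral_sum {ι : Type*} [Fintype ι] (z : ι → E) (m : M) :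
    tensorObjCentral f M (∑ i, z i) m = ∑ i, tensorObjCentral f M (z i) m := by
  simp only [tensorObjCentral, map_sum, AddMonoidHom.finsetSum_apply]

variable {M}

theorem exists_eq_sum_tensorObjCentral (hsurj : Function.Surjective (centralMul f E))
    (x : tensorObj (f : R →+* S) M) :
    ∃ (N : ℕ) (z : Fin N → E) (m : Fin N → M), x = ∑ l, tensorObjCentral f M (z l) (m l) := by
  have hadd (x y : tensorObj (f : R →+* S) M)
      (hx : ∃ (N : ℕ) (z : Fin N → E) (m : Fin N → M), x = ∑ l, tensorObjCentral f M (z l) (m l))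
      (hy : ∃ (N : ℕ) (z : Fin N → E) (m : Fin N → M), y = ∑ l, tensorObjCentral f M (z l) (m l)) :
      ∃ (N : ℕ) (z : Fin N → E) (m : Fin N → M),
        x + y = ∑ l, tensorObjCentral f M (z l) (m l) := by
    obtain ⟨N, z, m, rfl⟩ := hx
    obtain ⟨N', z', m', rfl⟩ := hy
    exact ⟨N + N', Fin.append z z', Fin.append m m', by simp [Fin.sum_univ_add]⟩
  induction x using tensorObj_induction with
  | h0 => exact ⟨0, Fin.elim0, Fin.elim0, by simp⟩
  | hadd x y hx hy => exact hadd x y hx hy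
  | hmk s m =>
    obtain ⟨t, rfl⟩ := hsurj s
    induction t with
    | zero => exact ⟨0, Fin.elim0, Fin.elim0, by simp⟩
    | add x y hx hy => rw [map_add, map_add, AddMonoidHom.add_apply]; exact hadd _ _ hx hy
    | tmul r z =>
      refine ⟨1, fun _ => z, fun _ => MulOpposite.op r • m, ?_⟩
      rw [Fin.sum_univ_one, tensorObjCentral, tensorObjMk_op_smul, centralMul_tmul]
      rfl

theorem exists_forall_eq_sum_tensorObjCentral (hsurj : Function.Surjective (centralMul f E))
    {J : Type} [Fintype J] (x : J → tensorObj (f : R →+* S) M) :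
    ∃ (ι : Type) (_ : Fintype ι) (z : ι → E) (m : ι → J → M),
      ∀ j, x j = ∑ l, tensorObjCentral f M (z l) (m l j) := by
  classical
  choose N z m h using fun j => exists_eq_sum_tensorObjCentral f hsurj (x j)
  -- One family `z` serves all coordinates: concatenate the separate expansions and pad with zeros.
  refine ⟨Σ j, Fin (N j), inferInstance, fun l => z l.1 l.2,
    fun l => Pi.single l.1 (m l.1 l.2), fun j => ?_⟩
  rw [Fintype.sum_sigma, Finset.sum_eq_single j]
  · simp [h]
  · intro i _ hij
    simp [Pi.single_eq_of_ne hij.symm]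
  · simp

omit [Algebra C E] [IsScalarTower C E S] in
theorem systemLhs_sum_tensorObjCentral {n t k : ℕ} (A : Matrix (Fin n) (Fin k) R)
    (B : Matrix (Fin t) (Fin k) R) {ι : Type*} [Fintype ι]
    (z : ι → E) (a : ι → Fin n → M) (b : ι → Fin t → M) (j : Fin k) :
    systemLhs (A.map (f : R →+* S)) (B.map (f : R →+* S)) (tensorObj (f : R →+* S) M)
        (∑ l, tensorObjCentral f M (z l) ∘ a l, ∑ l, tensorObjCentral f M (z l) ∘ b l) j =
      ∑ l, tensorObjCentral f M (z l) (systemLhs A B M (a l, b l) j) := by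
  rw [systemLhs_sum, Finset.sum_apply]
  refine Finset.sum_congr rfl fun l _ => ?_
  exact congrFun (systemLhs_map A B (f : R →+* S) _ (tensorObjCentral_op_smul f M (z l)) _ _) j

variable (M) [Module C M] [IsScalarTower C Rᵐᵒᵖ M]

theorem tensorObjCentral_smul (c : C) (z : E) (m : M) :
    tensorObjCentral f M z (c • m) = tensorObjCentral f M (c • z) m := by
  have h : (f : R →+* S) (algebraMap C R c) * algebraMap E S z = algebraMap E S (c • z) := by
    rw [Algebra.smul_def, map_mul, ← IsScalarTower.algebraMap_apply]
    simp
  rw [← algebraMap_smul Rᵐᵒᵖ c m, MulOpposite.algebraMap_apply, tensorObjCentral,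
    tensorObjMk_op_smul, h, tensorObjCentral]

/-- One direction of `M ⊗_R S ≅ E ⊗[C] M`; it suffices for carrying relations into a tensor product
over `C`. -/
theorem exists_tensorObj_to_tensorProduct (hbij : Function.Bijective (centralMul f E)) :
    ∃ Φ : tensorObj (f : R →+* S) M →+ E ⊗[C] M,
      ∀ (z : E) (m : M), Φ (tensorObjCentral f M z m) = z ⊗ₜ m := by
  let σ := AlgEquiv.ofBijective (centralMul f E) hbij
  -- The pairing `(r ⊗ z, m) ↦ z ⊗ m r`, transported to `S` through `σ`.
  let T : R ⊗[C] E →ₗ[C] M →ₗ[C] E ⊗[C] M := TensorProduct.lift <| LinearMap.mk₂ C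
    (fun r z => (TensorProduct.mk C E M z).comp (Algebra.lsmul C C M (MulOpposite.op r)))
    (fun r r' z => by ext m; simp [TensorProduct.tmul_add])
    (fun c r z => by ext m; simp)
    (fun r z z' => by ext m; simp)
    (fun c r z => by ext m; simp [TensorProduct.smul_tmul'])
  have hT (r : R) (z : E) (m : M) : T (r ⊗ₜ z) m = z ⊗ₜ (MulOpposite.op r • m) := by
    simp [T]
  let h : S →+ M →+ E ⊗[C] M :=
    (LinearMap.toAddMonoidHom' (σ₁₂ := RingHom.id C)).comp
      (T.toAddMonoidHom.comp (σ.symm : S →+ R ⊗[C] E))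
  have hh (t : R ⊗[C] E) (m : M) : h (σ t) m = T t m := by simp [h]
  obtain ⟨Φ, hΦ⟩ := exists_tensorObj_lift (f : R →+* S) M h fun s r m => by
    obtain ⟨t, rfl⟩ := σ.surjective s
    have h1 : f r * σ t = σ ((r ⊗ₜ 1) * t) := by
      simp [σ, centralMul_tmul]
    change _ = h (f r * σ t) m
    rw [h1, hh, hh]
    induction t with
    | zero => simp
    | tmul r' z => simp [hT, mul_smul]
    | add x y hx hy =>
      have h2 : f r * σ x = σ ((r ⊗ₜ 1) * x) := by simp [σ, centralMul_tmul]
      have h3 : f r * σ y = σ ((r ⊗ₜ 1) * y) := by simp [σ, centralMul_tmul]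
      rw [mul_add, map_add, map_add, LinearMap.add_apply, LinearMap.add_apply, hx h2, hy h3]
  refine ⟨Φ, fun z m => ?_⟩
  have h4 : algebraMap E S z = σ (1 ⊗ₜ z) := by simp [σ, centralMul_tmul]
  rw [tensorObjCentral, hΦ, h4, hh, hT]
  simp

variable {M}

/-- The equational criterion for flatness, applied to the single module `J → M` so that one set of
coefficients handles all equations of a system. -/
theorem vanishesTrivially_of_sum_tensorObjCentral_eq_zero [Module.Flat C E]
    (hbij : Function.Bijective (centralMul f E)) {ι J : Type*} [Fintype ι] [Fintype J]
    (w : ι → J → M) (z : ι → E)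
    (h : ∀ j, ∑ l, tensorObjCentral f M (z l) (w l j) = 0) :
    TensorProduct.VanishesTrivially C w z := by
  classical
  obtain ⟨Φ, hΦ⟩ := exists_tensorObj_to_tensorProduct f M hbij
  apply TensorProduct.vanishesTrivially_of_sum_tmul_eq_zero_of_rTensor_injective
  · exact Module.Flat.rTensor_preserves_injective_linearMap _ (Submodule.injective_subtype _)
  · apply (TensorProduct.comm C (J → M) E).injective
    apply (TensorProduct.piRight C C E fun _ : J => M).injective
    ext j
    have := congrArg Φ (h j)
    simpa [hΦ, Finset.sum_apply] using this

variable {n : ℕ} {φ ψ : PPFormula R n}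

/-- Rewriting a solution along the `y q` of a trivial relation makes each coefficient tuple a
solution of `φ` in `M`, hence of `ψ`. -/
theorem PPFormula.sol_map_tensorObj_subset [Module.Flat C E]
    (hbij : Function.Bijective (centralMul f E)) (h : φ.sol M ⊆ ψ.sol M) :
    (φ.map (f : R →+* S)).sol (tensorObj (f : R →+* S) M) ⊆
      (ψ.map (f : R →+* S)).sol (tensorObj (f : R →+* S) M) := by
  intro a ha
  obtain ⟨b, hb⟩ := (φ.mem_sol_map_iff _ _).1 ha
  obtain ⟨ι, _, z, m, hm⟩ := exists_forall_eq_sum_tensorObjCentral f hbij.2 (Sum.elim a b)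
  have ha' : a = ∑ l, tensorObjCentral f M (z l) ∘ (m l ∘ Sum.inl) := by
    ext i
    simpa using hm (Sum.inl i)
  have hb' : b = ∑ l, tensorObjCentral f M (z l) ∘ (m l ∘ Sum.inr) := by
    ext i
    simpa using hm (Sum.inr i)
  obtain ⟨k, α, y, hz, hα⟩ := vanishesTrivially_of_sum_tensorObjCentral_eq_zero f hbij
    (fun l => systemLhs φ.A φ.B M (m l ∘ Sum.inl, m l ∘ Sum.inr)) z fun j => by
      rw [← systemLhs_sum_tensorObjCentral, ← ha', ← hb']
      exact congrFun hb j
  have key : a = ∑ q, tensorObjCentral f M (y q) ∘ ∑ l, α l q • (m l ∘ Sum.inl) := by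
    ext i
    simp only [ha', Finset.sum_apply, Function.comp_apply, hz, tensorObjCentral_sum, map_sum,
      Pi.smul_apply, tensorObjCentral_smul]
    exact Finset.sum_comm
  rw [key]
  refine PPFormula.sum_mem_sol _ fun q => PPFormula.comp_mem_sol_map _ _ _
    (tensorObjCentral_op_smul f M (y q)) (h ?_)
  refine (φ.mem_sol_iff _).2 ⟨∑ l, α l q • (m l ∘ Sum.inr), ?_⟩
  rw [← hα q, systemLhs_sum]
  exact Finset.sum_congr rfl fun l _ => systemLhs_smul _ _ _ _ _

/-- A witness for `a ⊗ 1` over `S` is pulled back to `M` by specializing the coefficients of a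
trivial relation; `hone` lets the coefficient `1` of `a` specialize to `1`. -/
theorem PPFormula.sol_subset_of_sol_map_tensorObj_subset [Module.Flat C E]
    (hbij : Function.Bijective (centralMul f E))
    (hone : ∀ (k : ℕ) (a : Fin k → C) (y : Fin k → E), ∑ q, a q • y q = 1 →
      ∃ c : Fin k → C, ∑ q, a q * c q = 1)
    (h : (φ.map (f : R →+* S)).sol (tensorObj (f : R →+* S) M) ⊆
      (ψ.map (f : R →+* S)).sol (tensorObj (f : R →+* S) M)) :
    φ.sol M ⊆ ψ.sol M := by
  intro a ha
  obtain ⟨b, hb⟩ := (ψ.mem_sol_map_iff _ _).1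
    (h (φ.comp_mem_sol_map _ _ (tensorObjCentral_op_smul f M (1 : E)) ha))
  obtain ⟨ι, _, z, m, hm⟩ := exists_forall_eq_sum_tensorObjCentral f hbij.2 b
  -- The index `none` carries `a` with coefficient `1`, so free and quantified variables share one
  -- expansion.
  let z' : Option ι → E := fun l => l.elim 1 z
  let a' : Option ι → Fin n → M := fun l => l.elim a 0
  let b' : Option ι → Fin ψ.t → M := fun l => l.elim 0 m
  have ha' : tensorObjCentral f M (1 : E) ∘ a = ∑ l, tensorObjCentral f M (z' l) ∘ a' l := by
    ext i
    simp [Fintype.sum_option, z', a']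
  have hb' : b = ∑ l, tensorObjCentral f M (z' l) ∘ b' l := by
    ext i
    simp [Fintype.sum_option, z', b', hm]
  obtain ⟨k, α, y, hz, hα⟩ := vanishesTrivially_of_sum_tensorObjCentral_eq_zero f hbij
    (fun l => systemLhs ψ.A ψ.B M (a' l, b' l)) z' fun j => by
      rw [← systemLhs_sum_tensorObjCentral, ← ha', ← hb']
      exact congrFun hb j
  -- Substituting `c q` for `y q` sends each `z' l` to an element of `C` and `z' none = 1` to `1`,
  -- while `hα` keeps the system satisfied.
  obtain ⟨c, hc⟩ := hone k (α none) y (hz none).symm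
  refine (ψ.mem_sol_iff _).2 ⟨∑ l, (∑ q, α l q * c q) • b' l, ?_⟩
  have ha2 : a = ∑ l, (∑ q, α l q * c q) • a' l := by
    simp [Fintype.sum_option, a', hc]
  conv_lhs => rw [ha2, systemLhs_sum]
  have h1 (l : Option ι) :
      systemLhs ψ.A ψ.B M ((∑ q, α l q * c q) • a' l, (∑ q, α l q * c q) • b' l) =
        ∑ q, c q • α l q • systemLhs ψ.A ψ.B M (a' l, b' l) := by
    rw [systemLhs_smul, Finset.sum_smul]
    exact Finset.sum_congr rfl fun q _ => by rw [mul_comm, mul_smul]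
  simp only [h1]
  rw [Finset.sum_comm]
  simp only [← Finset.smul_sum, hα, smul_zero, Finset.sum_const_zero]

end CentralExtension

/-! ### Finiteness over the center and central syzygies. -/

section Center

theorem isNoetherianRing_center (K R : Type*) [Field K] [Ring R] [Algebra K R]
    [FiniteDimensional K R] : IsNoetherianRing (Subring.center R) :=
  show IsNoetherianRing (Subalgebra.center K R) from IsNoetherianRing.of_finite K _

theorem finite_center (K R : Type*) [Field K] [Ring R] [Algebra K R]
    [FiniteDimensional K R] : Module.Finite (Subring.center R) R :=
  show Module.Finite (Subalgebra.center K R) R from Module.Finite.of_restrictScalars_finite K _ _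

/-- The syzygies form a submodule of a finite free module over a Noetherian ring. -/
theorem exists_center_syzygies {R ι : Type*} [Ring R] [IsNoetherianRing (Subring.center R)]
    [Fintype ι] (a : ι → R) :
    ∃ (k : ℕ) (b : Fin k → ι → Subring.center R), (∀ q, ∑ i, a i * b q i = 0) ∧
      ∀ x : ι → Subring.center R, ∑ i, a i * x i = 0 →
        ∃ y : Fin k → Subring.center R, ∀ i, x i = ∑ q, b q i * y q := by
  let L := Fintype.linearCombination (Subring.center R) a
  have hL (x : ι → Subring.center R) : L x = ∑ i, a i * x i :=
    Finset.sum_congr rfl fun i _ => Subring.mem_center_iff.1 (x i).2 (a i) |>.symm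
  obtain ⟨k, b, hb⟩ := Submodule.fg_iff_exists_fin_generating_family.1
    (IsNoetherian.noetherian (LinearMap.ker L))
  refine ⟨k, b, fun q => ?_, fun x hx => ?_⟩
  · rw [← hL, ← LinearMap.mem_ker, ← hb]
    exact Submodule.subset_span ⟨q, rfl⟩
  · rw [← hL, ← LinearMap.mem_ker, ← hb, Submodule.mem_span_range_iff_exists_fun] at hx
    obtain ⟨y, rfl⟩ := hx
    exact ⟨y, fun i => by simp [Finset.sum_apply, mul_comm]⟩

variable {R S : Type u} [Ring R] [Ring S] {f : R →+* S}

/-- Used twice: with `a` in the center for flatness of `E`, and with `a` generating `R` for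
injectivity of `R ⊗[C] E → S`. -/
theorem IsElementaryExtension.exists_syzygies (hf : IsElementaryExtension f)
    [IsNoetherianRing (Subring.center R)] {ι : Type*} [Fintype ι] (a : ι → R)
    (x : ι → Subring.center S) (hx : ∑ i, f (a i) * x i = 0) :
    ∃ (k : ℕ) (b : Fin k → ι → Subring.center R) (y : Fin k → Subring.center S),
      (∀ q, ∑ i, a i * b q i = 0) ∧ ∀ i, (x i : S) = ∑ q, f (b q i) * y q := by
  obtain ⟨k, b, hb, h⟩ := exists_center_syzygies a
  obtain ⟨y, hy, hxy⟩ := hf.exists_central_syzygy a (fun q i => (b q i : R))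
    (fun x hx hax => by
      obtain ⟨y, hy⟩ := h (fun i => ⟨x i, hx i⟩) hax
      refine ⟨fun q => y q, fun q => (y q).2, fun i => ?_⟩
      simpa using congrArg Subtype.val (hy i))
    (fun i => (x i : S)) (fun i => (x i).2) hx
  exact ⟨k, b, fun q => ⟨y q, hy q⟩, hb, hxy⟩

/-- The map on centers induced by an elementary embedding. -/
def IsElementaryExtension.centerMap (hf : IsElementaryExtension f) :
    Subring.center R →+* Subring.center S :=
  (f.comp (Subring.center R).subtype).codRestrict _ fun c => hf.map_mem_center c.2

end Center

/-! ### Closedness of pp-pairs on `M` and on `M ⊗_R S`. -/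

section Closed

variable {R S : Type u} [Ring R] [Ring S] {f : R →+* S}

theorem IsElementaryExtension.sol_map_tensorObj_subset_iff (hf : IsElementaryExtension f)
    [IsNoetherianRing (Subring.center R)] [Module.Finite (Subring.center R) R]
    (M : ModuleCat.{u} Rᵐᵒᵖ) {n : ℕ} (φ ψ : PPFormula R n) :
    (φ.map f).sol (tensorObj f M) ⊆ (ψ.map f).sol (tensorObj f M) ↔ φ.sol M ⊆ ψ.sol M := by
  let C := Subring.center R
  let E := Subring.center S
  let _ : Algebra C E := hf.centerMap.toAlgebra
  let _ : Algebra C S := (f.comp C.subtype).toAlgebra' fun c s =>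
    (Subring.mem_center_iff.1 (hf.map_mem_center c.2) s).symm
  have : IsScalarTower C E S := IsScalarTower.of_algebraMap_eq fun _ => rfl
  let F : R →ₐ[C] S := { f with commutes' := fun _ => rfl }
  let _ : Module C M := Module.compHom M (algebraMap C Rᵐᵒᵖ)
  have : IsScalarTower C Rᵐᵒᵖ M := IsScalarTower.of_algebraMap_smul fun _ _ => rfl
  have hsmul (c : C) (z : E) : ((c • z : E) : S) = f c * z := rfl
  have : Module.Flat C E := Module.Flat.of_forall_isTrivialRelation fun {l a x} hx => by
    obtain ⟨k, b, y, hb, hxy⟩ := hf.exists_syzygies (fun i => (a i : R)) x (by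
      simpa [hsmul] using congrArg Subtype.val hx)
    refine ⟨k, fun i q => b q i, y, fun i => Subtype.ext ?_, fun q => Subtype.ext ?_⟩
    · simp [hxy, hsmul]
    · simpa using hb q
  have hmul (r : R) (z : E) : centralMul F E (r ⊗ₜ z) = f r * z := centralMul_tmul F r z
  obtain ⟨N, e, he⟩ := Module.Finite.exists_fin (R := C) (M := R)
  have hbij : Function.Bijective (centralMul F E) := by
    constructor
    · rw [injective_iff_map_eq_zero]
      intro t ht
      have hspan : ∃ z : Fin N → E, t = ∑ i, e i ⊗ₜ z i := by
        clear ht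
        induction t with
        | zero => exact ⟨0, by simp⟩
        | add x y hx hy =>
          obtain ⟨z, rfl⟩ := hx
          obtain ⟨z', rfl⟩ := hy
          exact ⟨z + z', by simp [TensorProduct.tmul_add, Finset.sum_add_distrib]⟩
        | tmul r z =>
          obtain ⟨c, rfl⟩ := (Submodule.mem_span_range_iff_exists_fun C).1
            (he ▸ Submodule.mem_top : r ∈ Submodule.span C (Set.range e))
          exact ⟨fun i => c i • z, by simp [TensorProduct.sum_tmul, TensorProduct.smul_tmul]⟩
      obtain ⟨z, rfl⟩ := hspan
      -- The generators `e` need not be independent; every relation among them over `E` comes from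
      -- relations over `C`, which already hold in `R`.
      obtain ⟨k, b, y, hb, hz⟩ := hf.exists_syzygies e z (by simpa [hmul] using ht)
      apply TensorProduct.sum_tmul_eq_zero_of_vanishesTrivially
      refine ⟨k, fun i q => b q i, y, fun i => Subtype.ext ?_, fun q => ?_⟩
      · simp [hz, hsmul]
      · rw [← hb q]
        exact Finset.sum_congr rfl fun i _ => (Subring.mem_center_iff.1 (b q i).2 (e i)).symm
    · intro s
      obtain ⟨z, hz, rfl⟩ := hf.exists_central_sum_eq e (fun r => by
        obtain ⟨c, rfl⟩ := (Submodule.mem_span_range_iff_exists_fun C).1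
          (he ▸ Submodule.mem_top : r ∈ Submodule.span C (Set.range e))
        exact ⟨fun i => c i, fun i => (c i).2,
          Finset.sum_congr rfl fun i _ => Subring.mem_center_iff.1 (c i).2 (e i)⟩) s
      exact ⟨∑ i, e i ⊗ₜ (⟨z i, hz i⟩ : E), by simp [hmul]⟩
  refine ⟨PPFormula.sol_subset_of_sol_map_tensorObj_subset F hbij fun k a y hy => ?_,
    PPFormula.sol_map_tensorObj_subset F hbij⟩
  obtain ⟨c, hc, h⟩ := hf.exists_central_sum_eq_one (fun q => (a q : R))
    ⟨fun q => y q, fun q => (y q).2, by simpa [hsmul] using congrArg Subtype.val hy⟩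
  exact ⟨fun q => ⟨c q, hc q⟩, Subtype.ext (by simpa using h)⟩

theorem IsElementaryExtension.closedOn_map_tensorObj_iff (hf : IsElementaryExtension f)
    [IsNoetherianRing (Subring.center R)] [Module.Finite (Subring.center R) R]
    (M : ModuleCat.{u} Rᵐᵒᵖ) (p : PPPair R) :
    (p.map f).ClosedOn (tensorObj f M) ↔ p.ClosedOn M :=
  ⟨fun h => ((hf.sol_map_tensorObj_subset_iff M p.φ p.ψ).1 h.subset).antisymm (p.le M),
    fun h => ((hf.sol_map_tensorObj_subset_iff M p.φ p.ψ).2 h.subset).antisymm ((p.map f).le _)⟩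

end Closed

theorem corollary5p17 {K : Type*} [Field K] {R S : Type u} [Ring R] [Algebra K R]
    [FiniteDimensional K R] [Ring S] (f : R →+* S) (hf : IsElementaryExtension f)
    (D : ObjectProperty (ModuleCat.{u} Rᵐᵒᵖ)) (hD : IsDefinable D) :
    definableRestriction f (tensorExtension f D) = D ∧
      tensorExtension f D ≤ directExtension f D := by
  have := isNoetherianRing_center K R
  have := finite_center K R
  obtain ⟨Φ, rfl⟩ := hD
  have hle : tensorExtension f (definedBy Φ) ≤ directExtension f (definedBy Φ) := by
    intro N hN
    -- The pairs `f_* Φ` define `directExtension f (definedBy Φ)`, so that class is definable and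
    -- only needs to contain each `M ⊗_R S`.
    have h := hN (definedBy (PPPair.map f '' Φ)) ⟨_, rfl⟩ (by
      rintro _ ⟨M, hM, rfl⟩ _ ⟨p, hp, rfl⟩
      exact (hf.closedOn_map_tensorObj_iff M p).2 (hM p hp))
    exact fun p hp => h _ ⟨p, hp, rfl⟩
  -- By `hle` every pair of `Φ` is among those defining the restriction. Conversely, a pair whose
  -- image is closed on the tensor extension is tested on `M ⊗_R S` itself and descends to `M`.
  refine ⟨le_antisymm (fun M hM p hp => hM p fun N hN => hle N hN p hp) fun M hM p hp => ?_, hle⟩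
  exact (hf.closedOn_map_tensorObj_iff M p).1 (hp _ fun E _ hE => hE _ ⟨M, hM, rfl⟩)
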